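/- Let $\mathcal H$ be a complex finite dimensional Hilbert space with $\dim\mathcal H\ge 2$, let $\mathcal L(\mathcal H)_+$ be the set of all positive semidefinite operators on $\mathcal H$, and let $\alpha\in\,]0,1[\,\cup\,]1,+\infty[$ be a fixed real number. For $A\in\mathcal L(\mathcal H)_+$ let $\operatorname{supp}A=(\ker A)^\perp$, and let $\widehat{\log}(A)$ be defined by functional calculus from the function $\widehat{\log}(t)=\log t$ for $t>0$, $\widehat{\log}(0)=0$. For $A,B\in\mathcal L(\mathcal H)_+$ define $D^\flat_\alpha(A\Vert B)\in[-\infty,+\infty]$ as follows. - If $A=0$, then $D^\flat_\alpha(A\Vert B)=-\infty$. - If $A\ne0$ and ($0<\alpha<1$ or $\operatorname{supp}A\subseteq\operatorname{supp}B$), then $$D^\flat_\alpha(A\Vert B)=\frac1{\alpha-1}\log\Big((\operatorname{tr}A)^{-1}\operatorname{tr}\big(P\exp(\alpha P\widehat{\log}(A)P+(1-\alpha)P\widehat{\log}(B)P)\big)\Big),$$ where $P$ is the orthogonal projection of $\mathcal H$ onto $\operatorname{supp}A\cap\operatorname{supp}B$ and $\log0=-\infty$. - If $A\neq 0$, $\alpha>1$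 and $\operatorname{supp}A\not\subseteq\operatorname{supp}B$, then $D^\flat_\alpha(A\Vert B)=+\infty$. Let $\phi:\mathcal L(\mathcal H)_+\to\mathcal L(\mathcal H)_+$ be a bijection satisfying $$D^\flat_\alpha(\phi(A)\Vert\phi(B))=D^\flat_\alpha(A\Vert B),\qquad A,B\in\mathcal L(\mathcal H)_+.$$ Then there exist either a unitary or an antiunitary operator $U$ on $\mathcal H$ and a positive scalar $\lambda>0$ such that $$\phi(A)=\lambda UAU^*,\qquad A\in\mathcal L(\mathcal H)_+.$$ -/

import Mathlib

noncomputable section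

namespace RenyiFlat

variable {H : Type*} [NormedAddCommGroup H] [InnerProductSpace ℂ H]

/-- `L(H)_+`: the positive semidefinite operators on `H`. -/
abbrev PosSemidefOp (H : Type*) [NormedAddCommGroup H] [InnerProductSpace ℂ H] : Type _ :=
  {A : H →L[ℂ] H // A.IsPositive}

/-- The support of an operator: the orthogonal complement of its kernel (for a positive
semidefinite operator on a finite dimensional space this is its range). -/
def supp (A : H →L[ℂ] H) : Submodule ℂ H :=
  (LinearMap.ker (A : H →ₗ[ℂ] H))ᗮ

/-- The trace, as a real number (used for operators whose trace is real). -/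
def tr (A : H →L[ℂ] H) : ℝ :=
  (LinearMap.trace ℂ H (A : H →ₗ[ℂ] H)).re

/-- The functional calculus of `log` extended by the value `0` at `0`;
indeed `Real.log 0 = 0`. On a finite dimensional space every spectrum is finite, so the function
is continuous on it. -/
def logHat [CompleteSpace H] (A : H →L[ℂ] H) : H →L[ℂ] H :=
  cfc Real.log A

/-- The orthogonal projection of `H` onto `supp A ∩ supp B`. -/
def suppProj [FiniteDimensional ℂ H] (A B : H →L[ℂ] H) : H →L[ℂ] H :=
  (supp A ⊓ supp B).starProjection

/-- `(tr A)⁻¹ tr (P exp (α P log^(A) P + (1 - α) P log^(B) P))`,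
with `P` the projection onto `supp A ∩ supp B`. -/
def flatQ [CompleteSpace H] [FiniteDimensional ℂ H] (α : ℝ) (A B : H →L[ℂ] H) : ℝ :=
  (tr A)⁻¹ * tr (suppProj A B *
    NormedSpace.exp (α • (suppProj A B * logHat A * suppProj A B) +
      (1 - α) • (suppProj A B * logHat B * suppProj A B)))

open Classical in
/-- The divergence `D^♭_α(A ‖ B)` of positive semidefinite operators, with values in `[-∞, ∞]`.
The logarithm is `ENNReal.log : [0, ∞] → [-∞, ∞]`, for which `log 0 = -∞`. -/
def flatD [CompleteSpace H] [FiniteDimensional ℂ H] (α : ℝ) (A B : PosSemidefOp H) : EReal :=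
  if A.1 = 0 then ⊥
  else if α < 1 ∨ supp A.1 ≤ supp B.1 then
    (((α - 1)⁻¹ : ℝ) : EReal) * ENNReal.log (ENNReal.ofReal (flatQ α A.1 B.1))
  else ⊤

end RenyiFlat

end

open ComplexConjugate

set_option linter.unusedSectionVars false

namespace RenyiFlat

/-! ### Wigner's theorem. -/

section Wigner

variable {E F : Type*} [NormedAddCommGroup E] [InnerProductSpace ℂ E]
  [NormedAddCommGroup F] [InnerProductSpace ℂ F]

/-! The value `⊤` of the divergence detects disjointness of supports (`α < 1`) or failure of
inclusion (`α > 1`). Either way `φ` induces an order automorphism `F` of the lattice of subspaces,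
hence a map on lines.

If `A` has rank one with support spanned by a unit vector `x`, then D(A‖B) = κ - ⟨x, log B x⟩
whenever `x` lies in supp B (`flatD_rank_one`). So if `x'` represents the image of the line of `x`,
the form of log φ(B) at `x'` is that of log B at `x` plus that of T = log φ(1). With log B = |y⟩⟨y|,
the operator W = log φ(B) - T satisfies 0 ≤ W ≤ 1 and ⟨y', Wy'⟩ = 1, hence W ≥ |y'⟩⟨y'|; that is,
|⟨x', y'⟩| ≤ |⟨x, y⟩|. The same argument for `F.symm` gives equality (`norm_inner_eq_of_lineRel`),
and Wigner's theorem yields a unitary or antiunitary `U` inducing `F` on lines. The fundamental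
theorem of projective geometry is not needed, so dimension two is no exception.

It remains to see that T is scalar. This follows by comparing D(1‖B) with D(φ(1)‖φ(B)) for suitable
B such that log φ(B) commutes with T. If T = t, then on supp φ(A) = U supp A the compression of log
φ(A) is that of U (log A) U* + t, so φ(A) = eᵗ U A U*. -/

theorem inner_self_eq_ofReal (x : E) : inner ℂ x x = ((‖x‖ ^ 2 : ℝ) : ℂ) := by
  rw [inner_self_eq_norm_sq_to_K]; simp

/-- Real parts are preserved, so `g` is additive. The sets where `g (I • u)` is `I • g u` or its
negative are then additive subgroups covering `E`, and a group is not the union of two proper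
subgroups. -/
theorem inner_map_eq_or_conj (g : E → F)
    (hg : ∀ u v, inner ℂ (g u) (g v) = inner ℂ u v ∨
      inner ℂ (g u) (g v) = conj (inner ℂ u v)) :
    (∀ u v, inner ℂ (g u) (g v) = inner ℂ u v) ∨
      (∀ u v, inner ℂ (g u) (g v) = conj (inner ℂ u v)) := by
  have hre : ∀ u v, (inner ℂ (g u) (g v)).re = (inner ℂ u v).re := fun u v => by
    rcases hg u v with h | h <;> rw [h]
    exact Complex.conj_re _
  have hself : ∀ u, inner ℂ (g u) (g u) = inner ℂ u u := fun u => by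
    rcases hg u u with h | h <;> rw [h]
    exact inner_conj_symm u u
  have hadd : ∀ u v, g (u + v) = g u + g v := fun u v => by
    have h : (inner ℂ (g (u + v) - g u - g v) (g (u + v) - g u - g v)).re =
        (inner ℂ (u + v - u - v) (u + v - u - v)).re := by
      simp only [inner_sub_left, inner_sub_right, Complex.sub_re, hre]
    rw [add_sub_cancel_left, sub_self, inner_zero_left] at h
    have h2 : g (u + v) - g u - g v = 0 := by
      rw [← norm_eq_zero, ← sq_eq_zero_iff, norm_sq_eq_re_inner (𝕜 := ℂ)]
      exact h
    rw [sub_sub, sub_eq_zero] at h2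
    exact h2
  have hI : ∀ u, g (Complex.I • u) = Complex.I • g u ∨
      g (Complex.I • u) = -(Complex.I • g u) := fun u => by
    have h1 := hself (Complex.I • u)
    have h2 := hself u
    have h4 := inner_conj_symm (𝕜 := ℂ) (g (Complex.I • u)) (g u)
    simp only [inner_smul_left, inner_smul_right, Complex.conj_I] at h1
    rcases hg u (Complex.I • u) with h | h
    · left
      rw [← sub_eq_zero, ← inner_self_eq_zero (𝕜 := ℂ)]
      simp only [inner_sub_left, inner_sub_right, inner_smul_left, inner_smul_right,
        Complex.conj_I, ← h4, h1, h2, h]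
      simp only [map_mul, Complex.conj_I, inner_conj_symm]
      ring
    · right
      rw [← sub_eq_zero, sub_neg_eq_add, ← inner_self_eq_zero (𝕜 := ℂ)]
      simp only [inner_add_left, inner_add_right, inner_smul_left, inner_smul_right,
        Complex.conj_I, ← h4, h1, h2, h]
      simp only [map_mul, Complex.conj_I, inner_conj_symm, map_neg]
      ring
  by_cases hp : ∀ u, g (Complex.I • u) = Complex.I • g u
  · left
    intro u v
    have := hre u (Complex.I • v)
    rw [hp, inner_smul_right, inner_smul_right] at this
    apply Complex.ext (hre u v)
    simpa using this
  by_cases hm : ∀ u, g (Complex.I • u) = -(Complex.I • g u)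
  · right
    intro u v
    have := hre u (Complex.I • v)
    rw [hm, inner_neg_right, inner_smul_right, inner_smul_right] at this
    apply Complex.ext (by rw [Complex.conj_re]; exact hre u v)
    rw [Complex.conj_im]
    simpa using this
  exfalso
  push Not at hp hm
  obtain ⟨u, hu⟩ := hp
  obtain ⟨v, hv⟩ := hm
  have hu' := (hI u).resolve_left hu
  have hv' := (hI v).resolve_right hv
  have key : ∀ w : F, Complex.I • w = -(Complex.I • w) → w = 0 := fun w hw => by
    have h2 : (2 : ℂ) • Complex.I • w = 0 := by
      rw [two_smul]; nth_rewrite 1 [hw]; exact neg_add_cancel _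
    exact (smul_eq_zero.1 ((smul_eq_zero.1 h2).resolve_left two_ne_zero)).resolve_left Complex.I_ne_zero
  rcases hI (u + v) with h | h
  · rw [smul_add, hadd, hadd, smul_add, hu', hv', add_left_inj] at h
    exact hu (by rw [hu', key (g u) h.symm]; simp)
  · rw [smul_add, hadd, hadd, smul_add, hu', hv', neg_add, add_right_inj] at h
    exact hv (by rw [hv', key (g v) h]; simp)

/-- The squared norm of each defect of semilinearity of `G` is `σ` of the corresponding expression
for the identity, which is 0. Surjectivity comes from the square of the map, which is ℂ-linear even
when `σ` is conjugation. -/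
theorem exists_linearIsometryEquiv_of_inner_map [FiniteDimensional ℂ E] (σ : ℂ →+* ℂ)
    [RingHomInvPair σ σ] (hσ : ∀ z, σ (conj z) = conj (σ z)) (hr : ∀ r : ℝ, σ r = r)
    (G : E → E) (hG : ∀ x y, inner ℂ (G x) (G y) = σ (inner ℂ x y)) :
    ∃ U : E ≃ₛₗᵢ[σ] E, ∀ x, U x = G x := by
  have hadd : ∀ x y, G (x + y) = G x + G y := fun x y => by
    have h : inner ℂ (G (x + y) - G x - G y) (G (x + y) - G x - G y) =
        σ (inner ℂ (x + y - x - y) (x + y - x - y)) := by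
      simp only [inner_sub_left, inner_sub_right, map_sub, hG]
    rw [add_sub_cancel_left, sub_self, inner_zero_left, map_zero, inner_self_eq_zero,
      sub_sub, sub_eq_zero] at h
    exact h
  have hsmul : ∀ (c : ℂ) x, G (c • x) = σ c • G x := fun c x => by
    have h : inner ℂ (G (c • x) - σ c • G x) (G (c • x) - σ c • G x) =
        σ (inner ℂ (c • x - c • x) (c • x - c • x)) := by
      simp only [inner_sub_left, inner_sub_right, map_sub, hG, inner_smul_left, inner_smul_right,
        map_mul, hσ]
      ring
    rw [sub_self, inner_zero_left, map_zero, inner_self_eq_zero, sub_eq_zero] at h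
    exact h
  have hnorm : ∀ x, ‖G x‖ = ‖x‖ := fun x => by
    have h := hG x x
    rw [inner_self_eq_ofReal, inner_self_eq_ofReal, hr] at h
    have h' : ‖G x‖ ^ 2 = ‖x‖ ^ 2 := Complex.ofReal_injective h
    exact (sq_eq_sq₀ (norm_nonneg _) (norm_nonneg _)).1 h'
  let L : E →ₛₗ[σ] E := { toFun := G, map_add' := hadd, map_smul' := hsmul }
  have hinj : Function.Injective L := by
    rw [injective_iff_map_eq_zero]
    intro x hx
    rw [← norm_eq_zero, ← hnorm x]
    exact norm_eq_zero.2 hx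
  have hsurj : Function.Surjective L := by
    have h : Function.Surjective (L.comp L : E →ₗ[ℂ] E) :=
      LinearMap.surjective_of_injective (hinj.comp hinj)
    intro y
    obtain ⟨x, hx⟩ := h y
    exact ⟨L x, hx⟩
  exact ⟨{ LinearEquiv.ofBijective L ⟨hinj, hsurj⟩ with norm_map' := hnorm }, fun x => rfl⟩

theorem exists_smul_eq_of_norm_inner_eq {x y : E} (hxy : ‖x‖ = ‖y‖)
    (h : ‖(inner ℂ x y : ℂ)‖ = ‖x‖ * ‖y‖) : ∃ c : ℂ, ‖c‖ = 1 ∧ y = c • x := by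
  by_cases hx : x = 0
  · refine ⟨1, by simp, ?_⟩
    rw [hx, norm_zero] at hxy
    rw [hx, norm_eq_zero.1 hxy.symm, smul_zero]
  · have hy : y ≠ 0 := by rwa [← norm_ne_zero_iff, ← hxy, norm_ne_zero_iff]
    obtain ⟨c, -, hc⟩ := (norm_inner_eq_norm_iff (𝕜 := ℂ) hx hy).1 h
    refine ⟨c, ?_, hc⟩
    rw [hc, norm_smul] at hxy
    have hx' : ‖x‖ ≠ 0 := norm_ne_zero_iff.2 hx
    field_simp at hxy
    exact hxy.symm

theorem norm_inner_self_eq (x : E) : ‖(inner ℂ x x : ℂ)‖ = ‖x‖ * ‖x‖ := by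
  simp [inner_self_eq_norm_sq_to_K, sq]

/-- Wigner's theorem in finite dimension. -/
theorem wigner [FiniteDimensional ℂ E] [Nontrivial E] (f : E → E)
    (hf : ∀ x y, ‖(inner ℂ (f x) (f y) : ℂ)‖ = ‖(inner ℂ x y : ℂ)‖) :
    (∃ U : E ≃ₗᵢ[ℂ] E, (∀ x y, inner ℂ (U x) (U y) = inner ℂ x y) ∧
        ∀ x, ∃ c : ℂ, ‖c‖ = 1 ∧ f x = c • U x) ∨
      (∃ U : E ≃ₗᵢ⋆[ℂ] E, (∀ x y, inner ℂ (U x) (U y) = conj (inner ℂ x y)) ∧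
        ∀ x, ∃ c : ℂ, ‖c‖ = 1 ∧ f x = c • U x) := by
  have hnorm : ∀ x, ‖f x‖ = ‖x‖ := fun x => by
    have h := hf x x
    rw [norm_inner_self_eq, norm_inner_self_eq] at h
    nlinarith [norm_nonneg (f x), norm_nonneg x]
  obtain ⟨e, he⟩ := exists_norm_eq E (zero_le_one' ℝ)
  have hee : inner ℂ e e = (1 : ℂ) := by rw [inner_self_eq_norm_sq_to_K, he]; simp
  set e' := f e with he'
  have hee' : inner ℂ e' e' = (1 : ℂ) := by rw [inner_self_eq_norm_sq_to_K, hnorm, he]; simp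
  let K := (ℂ ∙ e)ᗮ
  have hK : ∀ u : K, inner ℂ e (u : E) = (0 : ℂ) := fun u =>
    Submodule.mem_orthogonal_singleton_iff_inner_right.1 u.2
  have hK' : ∀ u : K, inner ℂ (u : E) e = (0 : ℂ) := fun u =>
    Submodule.mem_orthogonal_singleton_iff_inner_left.1 u.2
  -- The phases are fixed on the affine hyperplane `e + K`: dividing by `y u` makes the component of
  -- `f (e + u)` along `e'` equal to 1, and `g u` is what remains.
  let y : K → ℂ := fun u => inner ℂ e' (f (e + u))
  have hy : ∀ u, ‖y u‖ = 1 := fun u => by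
    simp only [y, he', hf, inner_add_right, hee, hK]; simp
  have hy0 : ∀ u, y u ≠ 0 := fun u => by rw [← norm_ne_zero_iff, hy]; exact one_ne_zero
  let g : K → E := fun u => (y u)⁻¹ • f (e + u) - e'
  have hgf : ∀ u : K, f (e + u) = y u • (e' + g u) := fun u => by
    simp only [g]; rw [add_sub_cancel, smul_inv_smul₀ (hy0 u)]
  have hge : ∀ u, inner ℂ e' (g u) = (0 : ℂ) := fun u => by
    simp only [g, inner_sub_right, inner_smul_right, hee']
    rw [inv_mul_cancel₀ (hy0 u), sub_self]
  have hge' : ∀ u, inner ℂ (g u) e' = (0 : ℂ) := fun u => by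
    rw [← inner_conj_symm, hge, map_zero]
  have h1 : ∀ u v, ‖1 + (inner ℂ (g u) (g v) : ℂ)‖ = ‖1 + (inner ℂ u v : ℂ)‖ := fun u v => by
    have h := hf (e + u) (e + v)
    rw [hgf, hgf, inner_smul_left, inner_smul_right, norm_mul, norm_mul, hy, RCLike.norm_conj, hy,
      one_mul, one_mul] at h
    simp only [inner_add_left, inner_add_right, hee, hee', hge, hge', hK, hK', add_zero,
      zero_add] at h
    exact h
  have hgn : ∀ u, ‖g u‖ = ‖u‖ := fun u => by
    have h := h1 u u
    have h2 : ∀ r : ℝ, 0 ≤ r → ‖1 + (r : ℂ)‖ = 1 + r := fun r hr => by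
      rw [← Complex.ofReal_one, ← Complex.ofReal_add, Complex.norm_real,
        Real.norm_of_nonneg (by positivity)]
    rw [inner_self_eq_ofReal, inner_self_eq_ofReal, h2 _ (by positivity),
      h2 _ (by positivity)] at h
    nlinarith [norm_nonneg (g u), norm_nonneg u]
  -- Equality in Cauchy–Schwarz: `f u` is orthogonal to `e'`, so its inner product with `f (e + u)`
  -- only sees `g u`.
  have hfg : ∀ u : K, ∃ c : ℂ, ‖c‖ = 1 ∧ g u = c • f u := fun u => by
    apply exists_smul_eq_of_norm_inner_eq
    · rw [hnorm, hgn]; rfl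
    have h := hf u (e + u)
    have h0 : inner ℂ (f u) e' = (0 : ℂ) := by
      rw [← norm_eq_zero, he', hf, hK', norm_zero]
    rw [hgf, inner_smul_right, norm_mul, hy, one_mul, inner_add_right, inner_add_right, h0, hK',
      zero_add, zero_add, norm_inner_self_eq] at h
    rw [h, hnorm, hgn]; rfl
  have h2 : ∀ u v, ‖(inner ℂ (g u) (g v) : ℂ)‖ = ‖(inner ℂ u v : ℂ)‖ := fun u v => by
    obtain ⟨c, hc, hcu⟩ := hfg u
    obtain ⟨d, hd, hdv⟩ := hfg v
    rw [hcu, hdv, inner_smul_left, inner_smul_right, norm_mul, norm_mul, RCLike.norm_conj, hc, hd,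
      one_mul, one_mul, hf]
    rfl
  have h3 : ∀ u v, inner ℂ (g u) (g v) = inner ℂ u v ∨
      inner ℂ (g u) (g v) = conj (inner ℂ u v) := fun u v => by
    -- Circles centred at 0 and -1 meet in at most a conjugate pair.
    have key : ∀ a b : ℂ, ‖1 + a‖ = ‖1 + b‖ → ‖a‖ = ‖b‖ → a = b ∨ a = conj b := by
      intro a b hab hab'
      have q1 : ‖1 + a‖ ^ 2 = ‖1 + b‖ ^ 2 := by rw [hab]
      have q2 : ‖a‖ ^ 2 = ‖b‖ ^ 2 := by rw [hab']
      rw [← Complex.normSq_eq_norm_sq, ← Complex.normSq_eq_norm_sq, Complex.normSq_apply,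
        Complex.normSq_apply] at q1 q2
      simp only [Complex.add_re, Complex.add_im, Complex.one_re, Complex.one_im] at q1
      have q3 : a.re = b.re := by linarith
      have q4 : (a.im - b.im) * (a.im + b.im) = 0 := by rw [q3] at q2; linarith
      rcases mul_eq_zero.1 q4 with h | h
      · exact Or.inl (Complex.ext q3 (by linarith))
      · exact Or.inr (Complex.ext (by simpa using q3) (by simp; linarith))
    exact key _ _ (h1 u v) (h2 u v)
  have hdec : ∀ x : E, ∃ u : K, x = (inner ℂ e x : ℂ) • e + u := fun x => by
    refine ⟨⟨x - (inner ℂ e x : ℂ) • e, ?_⟩, by simp⟩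
    rw [Submodule.mem_orthogonal_singleton_iff_inner_right]
    rw [inner_sub_right, inner_smul_right, hee, mul_one, sub_self]
  choose p hp using hdec
  have main : ∀ (σ : ℂ →+* ℂ) [RingHomInvPair σ σ], (∀ z, σ (conj z) = conj (σ z)) →
      (∀ r : ℝ, σ r = r) → (∀ u v, inner ℂ (g u) (g v) = σ (inner ℂ u v)) →
      ∃ U : E ≃ₛₗᵢ[σ] E, (∀ x y, inner ℂ (U x) (U y) = σ (inner ℂ x y)) ∧
        ∀ x, ∃ c : ℂ, ‖c‖ = 1 ∧ f x = c • U x := by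
    intro σ _ hσ hr hg
    have hG : ∀ x y, inner ℂ (σ (inner ℂ e x) • e' + g (p x)) (σ (inner ℂ e y) • e' + g (p y)) =
        σ (inner ℂ x y) := fun x y => by
      conv_rhs => rw [hp x, hp y]
      simp only [inner_add_left, inner_add_right, inner_smul_left, inner_smul_right, hee, hee', hge,
        hge', hK, hK', hg, map_add, map_mul, hσ, map_zero, map_one]
      rfl
    obtain ⟨U, hU⟩ := exists_linearIsometryEquiv_of_inner_map σ hσ hr _ hG
    have hUin : ∀ x y, inner ℂ (U x) (U y) = σ (inner ℂ x y) := fun x y => by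
      rw [hU, hU]; exact hG x y
    refine ⟨U, hUin, fun x => ?_⟩
    have hpK : ∀ u : K, p u = u := fun u => by
      have := hp u
      rw [hK, zero_smul, zero_add] at this
      exact Subtype.ext this.symm
    have hpe : ∀ u : K, p (e + u) = u := fun u => by
      have := hp (e + u)
      rw [inner_add_right, hee, hK, add_zero, one_smul, add_right_inj] at this
      exact Subtype.ext this.symm
    by_cases h0 : (inner ℂ e x : ℂ) = 0
    · obtain ⟨u, rfl⟩ : ∃ u : K, x = u :=
        ⟨p x, by have := hp x; rwa [h0, zero_smul, zero_add] at this⟩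
      obtain ⟨c, hc, hcu⟩ := hfg u
      have hc0 : c ≠ 0 := by rw [← norm_ne_zero_iff, hc]; exact one_ne_zero
      refine ⟨c⁻¹, by rw [norm_inv, hc, inv_one], ?_⟩
      rw [hU, hK, map_zero, zero_smul, zero_add, hpK, hcu, inv_smul_smul₀ hc0]
    · set a : ℂ := inner ℂ e x with ha
      have hx : x = a • (e + ((a⁻¹ • p x : K) : E)) := by
        conv_lhs => rw [hp x]
        rw [smul_add, Submodule.coe_smul, smul_inv_smul₀ h0]
      set z : E := e + ((a⁻¹ • p x : K) : E) with hz
      have hUz : f z = y (a⁻¹ • p x) • U z := by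
        rw [hz, hgf, hU, hpe, inner_add_right, hee, hK, add_zero, map_one, one_smul]
      have hσn : ‖σ a‖ = ‖a‖ := by
        have := U.norm_map (a • e)
        rw [map_smulₛₗ, norm_smul, norm_smul, U.norm_map, he, mul_one, mul_one] at this
        exact this
      -- `x` is a multiple of `z`, and `f z` is already a phase times `U z`; equality in
      -- Cauchy–Schwarz for the pair `z`, `x` is carried over by `f`.
      obtain ⟨c, hc, hcu⟩ := exists_smul_eq_of_norm_inner_eq (x := U x) (y := f x)
        (by rw [U.norm_map, hnorm]) (by
          have h := hf z x
          have hyz := hy (a⁻¹ • p x)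
          rw [hUz, inner_smul_left, norm_mul, RCLike.norm_conj, hyz, one_mul] at h
          have hUx : U x = σ a • U z := by rw [hx, map_smulₛₗ]
          have hzx : inner ℂ z x = a * inner ℂ z z := by
            conv_lhs => rw [hx]
            rw [inner_smul_right]
          have hxn : ‖x‖ = ‖a‖ * ‖z‖ := by
            conv_lhs => rw [hx]
            rw [norm_smul]
          rw [U.norm_map, hnorm, hUx, inner_smul_left, norm_mul, RCLike.norm_conj, hσn, h, hzx,
            norm_mul, norm_inner_self_eq, hxn]
          ring)
      exact ⟨c, hc, hcu⟩
  rcases inner_map_eq_or_conj g h3 with h | h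
  · exact Or.inl (main (RingHom.id ℂ) (by simp) (by simp) h)
  · exact Or.inr (main (starRingEnd ℂ) (by simp) (by simp) h)

end Wigner

/-! ### Functional calculus on eigenvectors, supports and positivity. -/

section Spectral

variable {H : Type*} [NormedAddCommGroup H] [InnerProductSpace ℂ H] [CompleteSpace H]
  [FiniteDimensional ℂ H]

theorem inner_apply_left {A : H →L[ℂ] H} (hA : IsSelfAdjoint A) (x y : H) :
    inner ℂ (A x) y = inner ℂ x (A y) :=
  hA.isSymmetric x y

theorem inner_apply_self_eq_re {A : H →L[ℂ] H} (hA : IsSelfAdjoint A) (x : H) :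
    inner ℂ x (A x) = ((inner ℂ x (A x)).re : ℂ) := by
  rw [eq_comm, ← Complex.conj_eq_iff_re, inner_conj_symm, inner_apply_left hA]

theorem finite_real_spectrum (A : H →L[ℂ] H) : (spectrum ℝ A).Finite := by
  have h : (spectrum ℂ A).Finite := by
    rw [← AlgEquiv.spectrum_eq (Module.End.toContinuousLinearMap H).symm]
    exact Module.End.finite_spectrum _
  exact (h.preimage (FaithfulSMul.algebraMap_injective ℝ ℂ).injOn).subset
    fun x hx => (spectrum.algebraMap_mem_iff ℂ).2 hx

theorem cfc_apply_eigenvector (f : ℝ → ℝ) {A : H →L[ℂ] H} (hA : IsSelfAdjoint A) {v : H} {a : ℝ}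
    (h : A v = (a : ℂ) • v) : cfc f A v = (f a : ℂ) • v := by
  classical
  -- The spectrum is finite, so a polynomial can replace `f`. Inserting `a` as a node covers the
  -- case `v = 0`, where `a` may lie outside the spectrum.
  set s : Finset ℝ := insert a (finite_real_spectrum A).toFinset with hs
  set q := Lagrange.interpolate s id f with hq
  have hev : ∀ t ∈ s, q.eval t = f t := fun t ht =>
    Lagrange.eval_interpolate_at_node f (Set.injOn_id _) ht
  have h1 : cfc f A = cfc q.eval A := cfc_congr fun t ht => (hev t (by simp [hs, ht])).symm
  rw [h1, cfc_polynomial q A hA, ← hev a (by simp [hs])]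
  induction q using Polynomial.induction_on with
  | C c => simp [Algebra.algebraMap_eq_smul_one]
  | add p q hp hq => simp_all [add_smul]
  | monomial n c _ =>
    have hpow : ∀ n : ℕ, (A ^ n) v = ((a ^ n : ℝ) : ℂ) • v := fun n => by
      induction n with
      | zero => simp
      | succ n ih =>
        rw [pow_succ, mul_apply_eq_comp, h, map_smul, ih, smul_smul]
        push_cast; ring_nf
    simp [Algebra.algebraMap_eq_smul_one, hpow]
    rw [← smul_smul, Complex.coe_smul]

theorem logHat_apply_eigenvector {A : H →L[ℂ] H} (hA : IsSelfAdjoint A) {v : H} {a : ℝ}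
    (h : A v = (a : ℂ) • v) : logHat A v = (Real.log a : ℂ) • v :=
  cfc_apply_eigenvector Real.log hA h

theorem exp_apply_eigenvector {A : H →L[ℂ] H} (hA : IsSelfAdjoint A) {v : H} {a : ℝ}
    (h : A v = (a : ℂ) • v) : NormedSpace.exp A v = (Real.exp a : ℂ) • v := by
  rw [← CFC.real_exp_eq_normedSpace_exp hA]
  exact cfc_apply_eigenvector Real.exp hA h

theorem isSelfAdjoint_logHat (A : H →L[ℂ] H) : IsSelfAdjoint (logHat A) :=
  cfc_predicate Real.log A

theorem logHat_one : logHat (1 : H →L[ℂ] H) = 0 := by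
  ext v
  rw [logHat_apply_eigenvector (a := 1) (IsSelfAdjoint.one _) (by simp)]
  simp

theorem exists_eigenbasis {A : H →L[ℂ] H} (hA : IsSelfAdjoint A) :
    ∃ (b : OrthonormalBasis (Fin (Module.finrank ℂ H)) ℂ H) (t : Fin (Module.finrank ℂ H) → ℝ),
      ∀ i, A (b i) = (t i : ℂ) • b i :=
  ⟨hA.isSymmetric.eigenvectorBasis rfl, hA.isSymmetric.eigenvalues rfl,
    fun i => hA.isSymmetric.apply_eigenvectorBasis rfl i⟩

theorem tr_eq_sum {ι : Type*} [Fintype ι] (b : OrthonormalBasis ι ℂ H) {A : H →L[ℂ] H}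
    {t : ι → ℝ} (h : ∀ i, A (b i) = (t i : ℂ) • b i) : tr A = ∑ i, t i := by
  rw [tr, LinearMap.trace_eq_sum_inner _ b, Complex.re_sum]
  refine Finset.sum_congr rfl fun i _ => ?_
  rw [ContinuousLinearMap.coe_coe, h, inner_smul_right, inner_self_eq_norm_sq_to_K,
    b.norm_eq_one]
  simp

theorem eigenvalue_nonneg {A : H →L[ℂ] H} (hA : A.IsPositive) {v : H} (hv : v ≠ 0) {a : ℝ}
    (h : A v = (a : ℂ) • v) : 0 ≤ a := by
  have h1 := hA.re_inner_nonneg_right v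
  rw [h, inner_smul_right, inner_self_eq_ofReal, ← Complex.ofReal_mul] at h1
  have h2 : 0 ≤ a * ‖v‖ ^ 2 := h1
  have : 0 < ‖v‖ ^ 2 := by positivity
  nlinarith

theorem tr_pos {A : H →L[ℂ] H} (hA : A.IsPositive) (h0 : A ≠ 0) : 0 < tr A := by
  obtain ⟨b, t, hb⟩ := exists_eigenbasis hA.isSelfAdjoint
  have ht : ∀ i, 0 ≤ t i := fun i => eigenvalue_nonneg hA (b.orthonormal.ne_zero i) (hb i)
  rw [tr_eq_sum b hb]
  refine (Finset.sum_nonneg fun i _ => ht i).lt_of_ne fun h => h0 ?_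
  rw [eq_comm, Finset.sum_eq_zero_iff_of_nonneg fun i _ => ht i] at h
  refine ContinuousLinearMap.coe_injective (b.toBasis.ext fun i => ?_)
  simp [hb, h i]

theorem tr_mul_comm (A B : H →L[ℂ] H) : tr (A * B) = tr (B * A) := by
  rw [tr, tr]
  exact congrArg Complex.re (LinearMap.trace_mul_comm ℂ (A : H →ₗ[ℂ] H) (B : H →ₗ[ℂ] H))

/-- The operator that is diagonal in a given orthonormal basis. -/
noncomputable def diagOp {ι : Type*} [Fintype ι] (b : OrthonormalBasis ι ℂ H) (t : ι → ℝ) : H →L[ℂ] H :=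
  ∑ i, (t i : ℂ) • InnerProductSpace.rankOne ℂ (b i) (b i)

theorem diagOp_apply {ι : Type*} [Fintype ι] (b : OrthonormalBasis ι ℂ H) (t : ι → ℝ) (i : ι) :
    diagOp b t (b i) = (t i : ℂ) • b i := by
  classical
  rw [diagOp, sum_apply, Finset.sum_eq_single i]
  · simp [b.norm_eq_one]
  · intro j _ hj
    simp [b.inner_eq_zero hj]
  · simp

theorem diagOp_isPositive {ι : Type*} [Fintype ι] (b : OrthonormalBasis ι ℂ H) {t : ι → ℝ}
    (ht : ∀ i, 0 ≤ t i) : (diagOp b t).IsPositive :=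
  ContinuousLinearMap.isPositive_sum _ fun i _ =>
    (InnerProductSpace.isPositive_rankOne_self (b i)).smul_of_nonneg (by exact_mod_cast ht i)

theorem clm_ext_basis {ι : Type*} [Fintype ι] (b : OrthonormalBasis ι ℂ H) {A B : H →L[ℂ] H}
    (h : ∀ i, A (b i) = B (b i)) : A = B :=
  ContinuousLinearMap.coe_injective (b.toBasis.ext fun i => by simpa using h i)

theorem exists_logHat_eq {X : H →L[ℂ] H} (hX : IsSelfAdjoint X) :
    ∃ B : PosSemidefOp H, supp B.1 = ⊤ ∧ logHat B.1 = X := by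
  obtain ⟨b, t, hb⟩ := exists_eigenbasis hX
  have hpos := diagOp_isPositive b (t := fun i => Real.exp (t i)) fun i => (Real.exp_pos _).le
  refine ⟨⟨diagOp b fun i => Real.exp (t i), hpos⟩, ?_, ?_⟩
  · rw [supp, Submodule.orthogonal_eq_top_iff, LinearMap.ker_eq_bot']
    intro v hv
    refine b.toBasis.ext_elem fun i => ?_
    have h1 : inner ℂ (b i) (diagOp b (fun i => Real.exp (t i)) v) = (0 : ℂ) := by
      rw [show diagOp b (fun i => Real.exp (t i)) v = 0 from hv, inner_zero_right]
    rw [← hpos.inner_left_eq_inner_right, diagOp_apply, inner_smul_left] at h1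
    have h2 := (mul_eq_zero.1 h1).resolve_left (by simp)
    simpa [b.repr_apply_apply] using h2
  · refine clm_ext_basis b fun i => ?_
    rw [logHat_apply_eigenvector hpos.isSelfAdjoint (diagOp_apply b _ i), Real.log_exp, hb]

theorem apply_mem_supp {A : H →L[ℂ] H} (hA : IsSelfAdjoint A) (v : H) : A v ∈ supp A := by
  rw [supp, Submodule.mem_orthogonal]
  intro u hu
  rw [← inner_apply_left hA, show A u = 0 from hu, inner_zero_left]

/-- `logHat` vanishes on the eigenspaces of both 0 and 1; membership in the support removes this
ambiguity, and then the logarithm is injective. -/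
theorem apply_eq_of_logHat_apply {A : H →L[ℂ] H} (hA : A.IsPositive) {v : H} (hv : v ∈ supp A)
    {l : ℝ} (h : logHat A v = (l : ℂ) • v) : A v = (Real.exp l : ℂ) • v := by
  obtain ⟨b, t, hb⟩ := exists_eigenbasis hA.isSelfAdjoint
  have ht : ∀ i, 0 ≤ t i := fun i => eigenvalue_nonneg hA (b.orthonormal.ne_zero i) (hb i)
  refine b.toBasis.ext_elem fun i => ?_
  have hAi : inner ℂ (b i) (A v) = (t i : ℂ) * inner ℂ (b i) v := by
    rw [← hA.inner_left_eq_inner_right, hb, inner_smul_left, Complex.conj_ofReal]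
  have hLi : inner ℂ (b i) (logHat A v) = (Real.log (t i) : ℂ) * inner ℂ (b i) v := by
    rw [← ContinuousLinearMap.adjoint_inner_left, (isSelfAdjoint_logHat A).adjoint_eq,
      logHat_apply_eigenvector hA.isSelfAdjoint (hb i), inner_smul_left, Complex.conj_ofReal]
  rw [h, inner_smul_right] at hLi
  suffices inner ℂ (b i) (A v) = (Real.exp l : ℂ) * inner ℂ (b i) v by
    simpa [b.repr_apply_apply] using this
  rw [hAi]
  by_cases h0 : inner ℂ (b i) v = (0 : ℂ)
  · simp [h0]
  have hti : t i ≠ 0 := fun h1 => h0 <|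
    (Submodule.mem_orthogonal _ _).1 hv (b i) (by simp [hb, h1])
  have h2 := mul_right_cancel₀ h0 hLi
  rw [Complex.ofReal_injective h2, Real.exp_log ((ht i).lt_of_ne hti.symm)]

theorem logHat_apply_of_mem_ker {A : H →L[ℂ] H} (hA : IsSelfAdjoint A) {v : H} (h : A v = 0) :
    logHat A v = 0 := by
  rw [logHat_apply_eigenvector (a := 0) hA (by simpa using h)]
  simp

theorem logHat_apply_mem_supp {A : H →L[ℂ] H} (hA : IsSelfAdjoint A) (v : H) :
    logHat A v ∈ supp A := by
  rw [supp, Submodule.mem_orthogonal]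
  intro u hu
  rw [← ContinuousLinearMap.adjoint_inner_left, (isSelfAdjoint_logHat A).adjoint_eq,
    logHat_apply_of_mem_ker hA hu, inner_zero_left]

theorem supp_starProjection (M : Submodule ℂ H) : supp M.starProjection = M := by
  rw [supp, Submodule.ker_starProjection, Submodule.orthogonal_orthogonal]

theorem starProjection_isPositive (M : Submodule ℂ H) : M.starProjection.IsPositive :=
  .of_isStarProjection isStarProjection_starProjection

theorem supp_eq_bot_iff {A : H →L[ℂ] H} : supp A = ⊥ ↔ A = 0 := by
  rw [supp, Submodule.orthogonal_eq_bot_iff, LinearMap.ker_eq_top]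
  exact ⟨fun h => ContinuousLinearMap.coe_injective h, fun h => by rw [h]; rfl⟩

theorem _root_.ContinuousLinearMap.IsPositive.apply_eq_zero {A : H →L[ℂ] H} (hA : A.IsPositive)
    {x : H} (h : (inner ℂ x (A x)).re = 0) : A x = 0 := by
  obtain ⟨b, t, hb⟩ := exists_eigenbasis hA.isSelfAdjoint
  have ht : ∀ i, 0 ≤ t i := fun i => eigenvalue_nonneg hA (b.orthonormal.ne_zero i) (hb i)
  have hAi : ∀ i, inner ℂ (b i) (A x) = (t i : ℂ) * inner ℂ (b i) x := fun i => by
    rw [← inner_apply_left hA.isSelfAdjoint, hb, inner_smul_left, Complex.conj_ofReal]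
  have hterm : ∀ i, (inner ℂ x (b i) * inner ℂ (b i) (A x) : ℂ).re =
      t i * ‖(inner ℂ (b i) x : ℂ)‖ ^ 2 := fun i => by
    rw [hAi, ← inner_conj_symm, mul_left_comm, ← Complex.normSq_eq_conj_mul_self,
      ← Complex.ofReal_mul, Complex.ofReal_re, Complex.normSq_eq_norm_sq]
  rw [← b.sum_inner_mul_inner, Complex.re_sum, Finset.sum_congr rfl fun i _ => hterm i,
    Finset.sum_eq_zero_iff_of_nonneg fun i _ => mul_nonneg (ht i) (sq_nonneg _)] at h
  refine b.toBasis.ext_elem fun i => ?_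
  have hi : inner ℂ (b i) (A x) = (0 : ℂ) := by
    rw [hAi]
    rcases mul_eq_zero.1 (h i (Finset.mem_univ i)) with h | h
    · simp [h]
    · simp [norm_eq_zero.1 (pow_eq_zero_iff two_ne_zero |>.1 h)]
  simpa [b.repr_apply_apply] using hi

/-- The positive operator `1 - W` has vanishing form at `y`, so `W y = y`. Hence `W` splits along
`y` and its orthogonal complement, where its form is nonnegative. -/
theorem norm_inner_sq_le_of_bounds {W : H →L[ℂ] H} (hW : IsSelfAdjoint W)
    (h1 : ∀ x, (inner ℂ x (W x)).re ≤ ‖x‖ ^ 2) (h0 : ∀ x, 0 ≤ (inner ℂ x (W x)).re)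
    {y : H} (hy : ‖y‖ = 1) (hyW : (inner ℂ y (W y)).re = 1) (x : H) :
    ‖(inner ℂ x y : ℂ)‖ ^ 2 ≤ (inner ℂ x (W x)).re := by
  have hsa : IsSelfAdjoint (1 - W) := (IsSelfAdjoint.one _).sub hW
  have hre : ∀ x, (inner ℂ x ((1 - W) x)).re = ‖x‖ ^ 2 - (inner ℂ x (W x)).re := fun x => by
    rw [sub_apply, inner_sub_right, Complex.sub_re, one_apply_eq_self,
      inner_self_eq_ofReal, Complex.ofReal_re]
  have hpos : (1 - W).IsPositive := by
    refine ⟨hsa.isSymmetric, fun x => ?_⟩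
    rw [ContinuousLinearMap.reApplyInnerSelf_apply, inner_apply_left hsa]
    exact (sub_nonneg.2 (h1 x)).trans_eq (hre x).symm
  have hWy : W y = y := by
    have h := hpos.apply_eq_zero (x := y) (by rw [hre, hyW, hy]; norm_num)
    rw [sub_apply, sub_eq_zero] at h
    exact h.symm
  set c : ℂ := inner ℂ y x with hc
  set z : H := x - c • y with hz
  have hx : x = c • y + z := by rw [hz]; abel
  have hyy : inner ℂ y y = (1 : ℂ) := by rw [inner_self_eq_ofReal, hy]; simp
  have hyz : inner ℂ y z = (0 : ℂ) := by
    rw [hz, inner_sub_right, inner_smul_right, hyy, ← hc]; ring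
  have hyWz : inner ℂ y (W z) = (0 : ℂ) := by rw [← inner_apply_left hW, hWy, hyz]
  have hzy : inner ℂ z y = (0 : ℂ) := by rw [← inner_conj_symm, hyz, map_zero]
  have hxW : inner ℂ x (W x) = ((‖c‖ ^ 2 : ℝ) : ℂ) + inner ℂ z (W z) := by
    rw [hx, map_add, map_smul, hWy]
    simp only [inner_add_left, inner_add_right, inner_smul_left, inner_smul_right, hyy, hzy, hyWz]
    rw [← Complex.normSq_eq_norm_sq, Complex.normSq_eq_conj_mul_self]
    ring
  rw [hxW, norm_inner_symm, ← hc, Complex.add_re, Complex.ofReal_re]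
  linarith [h0 z]

theorem clm_ext_re_inner {A B : H →L[ℂ] H} (hA : IsSelfAdjoint A) (hB : IsSelfAdjoint B)
    (h : ∀ x, (inner ℂ x (A x)).re = (inner ℂ x (B x)).re) : A = B := by
  refine ContinuousLinearMap.coe_injective ((ext_inner_map _ _).1 fun x => ?_)
  rw [ContinuousLinearMap.coe_coe, ContinuousLinearMap.coe_coe, inner_apply_left hA,
    inner_apply_left hB, inner_apply_self_eq_re hA, inner_apply_self_eq_re hB, h]

end Spectral

/-! ### Finiteness and special values of the divergence. -/

section Divergence

variable {H : Type*} [NormedAddCommGroup H] [InnerProductSpace ℂ H] [CompleteSpace H]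
  [FiniteDimensional ℂ H]

theorem isSelfAdjoint_suppProj (A B : H →L[ℂ] H) : IsSelfAdjoint (suppProj A B) :=
  isSelfAdjoint_starProjection _

theorem suppProj_eq {A B : H →L[ℂ] H} {M : Submodule ℂ H} (h : supp A ⊓ supp B = M) :
    suppProj A B = M.starProjection := by
  subst h
  rfl

theorem suppProj_mul_self (A B : H →L[ℂ] H) : suppProj A B * suppProj A B = suppProj A B :=
  isStarProjection_starProjection.isIdempotentElem

theorem isSelfAdjoint_conj {P L : H →L[ℂ] H} (hP : IsSelfAdjoint P) (hL : IsSelfAdjoint L) :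
    IsSelfAdjoint (P * L * P) := by
  have h := hL.conjugate P
  rwa [hP.star_eq] at h

theorem isSelfAdjoint_exponent (α : ℝ) {P L M : H →L[ℂ] H} (hP : IsSelfAdjoint P)
    (hL : IsSelfAdjoint L) (hM : IsSelfAdjoint M) :
    IsSelfAdjoint (α • (P * L * P) + (1 - α) • (P * M * P)) :=
  ((IsSelfAdjoint.all α).smul (isSelfAdjoint_conj hP hL)).add
    ((IsSelfAdjoint.all (1 - α)).smul (isSelfAdjoint_conj hP hM))

theorem exp_isPositive {K : H →L[ℂ] H} (hK : IsSelfAdjoint K) :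
    (NormedSpace.exp K).IsPositive :=
  (ContinuousLinearMap.nonneg_iff_isPositive _).1 hK.exp_nonneg

theorem eq_zero_of_exp_apply_eq_zero (K : H →L[ℂ] H) {v : H} (h : NormedSpace.exp K v = 0) :
    v = 0 := by
  let _ : NormedAlgebra ℚ (H →L[ℂ] H) := NormedAlgebra.restrictScalars ℚ ℂ _
  obtain ⟨u, hu⟩ := NormedSpace.isUnit_exp K
  have h1 : (↑u⁻¹ * ↑u : H →L[ℂ] H) v = 0 := by
    rw [hu, mul_apply_eq_comp, h, map_zero]
  simpa using h1

theorem flatQ_pos (α : ℝ) {A B : H →L[ℂ] H} (hA : A.IsPositive) (hA0 : A ≠ 0)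
    (h : supp A ⊓ supp B ≠ ⊥) : 0 < flatQ α A B := by
  refine mul_pos (inv_pos.2 (tr_pos hA hA0)) ?_
  have hP := isSelfAdjoint_suppProj A B
  set P := suppProj A B
  have hK := isSelfAdjoint_exponent α hP (isSelfAdjoint_logHat A) (isSelfAdjoint_logHat B)
  set K := α • (P * logHat A * P) + (1 - α) • (P * logHat B * P)
  have hE := exp_isPositive hK
  -- Cyclicity turns the product into a positive operator, nonzero because the exponential is
  -- positive and invertible.
  have htr : tr (P * NormedSpace.exp K) = tr (P * NormedSpace.exp K * P) := by
    rw [tr_mul_comm (P * _) P, ← mul_assoc, suppProj_mul_self]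
  rw [htr]
  obtain ⟨v, hv, hv0⟩ := (Submodule.ne_bot_iff _).1 h
  have hPv : P v = v := Submodule.starProjection_eq_self_iff.2 hv
  refine tr_pos ?_ fun h0 => hv0 (eq_zero_of_exp_apply_eq_zero K (hE.apply_eq_zero ?_))
  · exact hE.conj_starProjection (supp A ⊓ supp B)
  · have h1 : inner ℂ v ((P * NormedSpace.exp K * P) v) = (0 : ℂ) := by
      rw [h0, zero_apply, inner_zero_right]
    rw [mul_apply_eq_comp, mul_apply_eq_comp, hPv, ← inner_apply_left hP, hPv] at h1
    rw [h1, Complex.zero_re]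

theorem flatD_eq_of_flatQ_pos {α : ℝ} {A B : PosSemidefOp H} (hA0 : A.1 ≠ 0)
    (h : α < 1 ∨ supp A.1 ≤ supp B.1) (hQ : 0 < flatQ α A.1 B.1) :
    flatD α A B = (((α - 1)⁻¹ * Real.log (flatQ α A.1 B.1) : ℝ) : EReal) := by
  rw [flatD, if_neg hA0, if_pos h, ENNReal.log_ofReal_of_pos hQ, EReal.coe_mul]

theorem flatD_of_eq_zero (α : ℝ) {A : PosSemidefOp H} (h : A.1 = 0) (B : PosSemidefOp H) :
    flatD α A B = ⊥ := by
  rw [flatD, if_pos h]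

theorem flatD_self_ne_bot (α : ℝ) {A : PosSemidefOp H} (h : A.1 ≠ 0) : flatD α A A ≠ ⊥ := by
  rw [flatD_eq_of_flatQ_pos h (Or.inr le_rfl) (flatQ_pos α A.2 h (by
    rwa [inf_idem, ne_eq, supp_eq_bot_iff]))]
  exact EReal.coe_ne_bot _

theorem flatD_eq_top_iff_of_lt {α : ℝ} (hα : α < 1) {A : PosSemidefOp H} (hA : A.1 ≠ 0)
    (B : PosSemidefOp H) : flatD α A B = ⊤ ↔ supp A.1 ⊓ supp B.1 = ⊥ := by
  by_cases h : supp A.1 ⊓ supp B.1 = ⊥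
  · refine iff_of_true ?_ h
    rw [flatD, if_neg hA, if_pos (Or.inl hα), flatQ]
    have hP : suppProj A.1 B.1 = 0 := by
      rw [suppProj_eq h, Submodule.starProjection_bot]
    have htr : tr (0 : H →L[ℂ] H) = 0 := by simp [tr]
    rw [hP, zero_mul, htr, mul_zero, ENNReal.ofReal_zero, ENNReal.log_zero,
      EReal.coe_mul_bot_of_neg (inv_lt_zero.2 (sub_neg.2 hα))]
  · refine iff_of_false ?_ h
    rw [flatD_eq_of_flatQ_pos hA (Or.inl hα) (flatQ_pos α A.2 hA h)]
    exact EReal.coe_ne_top _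

theorem flatD_eq_top_iff_of_gt {α : ℝ} (hα : 1 < α) {A : PosSemidefOp H} (hA : A.1 ≠ 0)
    (B : PosSemidefOp H) : flatD α A B = ⊤ ↔ ¬ supp A.1 ≤ supp B.1 := by
  by_cases h : supp A.1 ≤ supp B.1
  · refine iff_of_false ?_ (not_not.2 h)
    rw [flatD_eq_of_flatQ_pos hA (Or.inr h) (flatQ_pos α A.2 hA (by
      rwa [inf_eq_left.2 h, ne_eq, supp_eq_bot_iff]))]
    exact EReal.coe_ne_top _
  · refine iff_of_true ?_ h
    rw [flatD, if_neg hA, if_neg (not_or.2 ⟨hα.not_gt, h⟩)]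

theorem starProjection_singleton_conj {x : H} (hx : ‖x‖ = 1) {L : H →L[ℂ] H}
    (hL : IsSelfAdjoint L) :
    (ℂ ∙ x).starProjection * L * (ℂ ∙ x).starProjection =
      (inner ℂ x (L x)).re • (ℂ ∙ x).starProjection := by
  ext v
  rw [mul_apply_eq_comp, mul_apply_eq_comp, smul_apply]
  rw [Submodule.starProjection_unit_singleton ℂ hx v, map_smul, map_smul,
    Submodule.starProjection_unit_singleton ℂ hx, inner_apply_self_eq_re hL, Complex.ofReal_re,
    smul_comm, Complex.coe_smul]

theorem exp_smul_mul_starProjection (r : ℝ) (M : Submodule ℂ H) :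
    NormedSpace.exp (r • M.starProjection) * M.starProjection = Real.exp r • M.starProjection := by
  ext v
  rw [mul_apply_eq_comp, smul_apply, exp_apply_eigenvector (a := r)
    ((IsSelfAdjoint.all r).smul (isSelfAdjoint_starProjection M)), Complex.coe_smul]
  rw [smul_apply, Submodule.starProjection_eq_self_iff.2 (Submodule.starProjection_apply_mem _ _),
    Complex.coe_smul]

theorem tr_smul (r : ℝ) (A : H →L[ℂ] H) : tr (r • A) = r * tr A := by
  rw [← Complex.coe_smul, tr, ContinuousLinearMap.toLinearMap_smul, map_smul, smul_eq_mul,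
    Complex.re_ofReal_mul, tr]

/-- Compressions to a line are scalar, so the exponential factorises; the coefficient `1 - α` of log
B cancels against the prefactor `(α - 1)⁻¹`, leaving -1. All dependence on `A` beyond its line is in
`κ`. -/
theorem flatD_rank_one {α : ℝ} (hα : α ≠ 1) {A : PosSemidefOp H} {x : H} (hx : ‖x‖ = 1)
    (hA : supp A.1 = ℂ ∙ x) : ∃ κ : ℝ, ∀ B : PosSemidefOp H, x ∈ supp B.1 →
      flatD α A B = ((κ - (inner ℂ x (logHat B.1 x)).re : ℝ) : EReal) := by
  have hx0 : x ≠ 0 := by rw [← norm_ne_zero_iff, hx]; exact one_ne_zero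
  have hspan : (ℂ ∙ x) ≠ ⊥ := by rwa [ne_eq, Submodule.span_singleton_eq_bot]
  have hA0 : A.1 ≠ 0 := by rwa [ne_eq, ← supp_eq_bot_iff, hA]
  refine ⟨(α - 1)⁻¹ * (Real.log ((tr A.1)⁻¹ * tr (ℂ ∙ x).starProjection) +
    α * (inner ℂ x (logHat A.1 x)).re), fun B hB => ?_⟩
  have hle : supp A.1 ≤ supp B.1 := by
    rwa [hA, Submodule.span_singleton_le_iff_mem]
  have hP : suppProj A.1 B.1 = (ℂ ∙ x).starProjection :=
    suppProj_eq (by rw [inf_eq_left.2 hle, hA])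
  have htr : 0 < tr (ℂ ∙ x).starProjection :=
    tr_pos (starProjection_isPositive _) (by rwa [ne_eq, ← supp_eq_bot_iff, supp_starProjection])
  have hQ : flatQ α A.1 B.1 = ((tr A.1)⁻¹ * tr (ℂ ∙ x).starProjection) *
      Real.exp (α * (inner ℂ x (logHat A.1 x)).re +
        (1 - α) * (inner ℂ x (logHat B.1 x)).re) := by
    rw [flatQ, hP, starProjection_singleton_conj hx (isSelfAdjoint_logHat _),
      starProjection_singleton_conj hx (isSelfAdjoint_logHat _), smul_smul, smul_smul, ← add_smul,
      tr_mul_comm, exp_smul_mul_starProjection, tr_smul]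
    ring
  rw [flatD_eq_of_flatQ_pos hA0 (Or.inr hle) (flatQ_pos α A.2 hA0 (by
    rwa [inf_eq_left.2 hle, hA])), hQ, Real.log_mul
    (mul_pos (inv_pos.2 (tr_pos A.2 hA0)) htr).ne' (Real.exp_ne_zero _), Real.log_exp]
  congr 1
  have h1 : α - 1 ≠ 0 := sub_ne_zero.2 hα
  field_simp
  ring

theorem flatD_of_supp_eq_top {α : ℝ} {A B : PosSemidefOp H} (hA0 : A.1 ≠ 0)
    (hA : supp A.1 = ⊤) (hB : supp B.1 = ⊤) :
    0 < flatQ α A.1 B.1 ∧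
    flatQ α A.1 B.1 =
      (tr A.1)⁻¹ * tr (NormedSpace.exp (α • logHat A.1 + (1 - α) • logHat B.1)) ∧
    flatD α A B = (((α - 1)⁻¹ * Real.log (flatQ α A.1 B.1) : ℝ) : EReal) := by
  have hpos := flatQ_pos α (B := B.1) A.2 hA0 (by
    rwa [hB, inf_top_eq, ne_eq, supp_eq_bot_iff])
  refine ⟨hpos, ?_, flatD_eq_of_flatQ_pos hA0 (Or.inr (by rw [hA, hB])) hpos⟩
  have hP : suppProj A.1 B.1 = 1 := by
    rw [suppProj_eq (M := ⊤) (by rw [hA, hB, inf_top_eq]), Submodule.starProjection_top']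
  rw [flatQ, hP]
  simp only [one_mul, mul_one]

end Divergence

/-! ### Action on supports and lines; preservation of transition probabilities. -/

section Preservers

variable {H : Type*} [NormedAddCommGroup H] [InnerProductSpace ℂ H] [CompleteSpace H]
  [FiniteDimensional ℂ H]

theorem val_eq_zero_iff_of_flatD {α : ℝ} {φ : PosSemidefOp H → PosSemidefOp H}
    (hpres : ∀ A B, flatD α (φ A) (φ B) = flatD α A B) (A : PosSemidefOp H) :
    (φ A).1 = 0 ↔ A.1 = 0 := by
  have h := hpres A A
  constructor <;> intro h0 <;> by_contra h1
  · rw [flatD_of_eq_zero α h0] at h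
    exact flatD_self_ne_bot α h1 h.symm
  · rw [flatD_of_eq_zero α h0] at h
    exact flatD_self_ne_bot α h1 h

theorem supp_le_iff_of_flatD {α : ℝ} (hα : α ≠ 1) {φ : PosSemidefOp H → PosSemidefOp H}
    (hφ : Function.Bijective φ) (hpres : ∀ A B, flatD α (φ A) (φ B) = flatD α A B)
    (A B : PosSemidefOp H) : supp (φ A).1 ≤ supp (φ B).1 ↔ supp A.1 ≤ supp B.1 := by
  have hz := val_eq_zero_iff_of_flatD hpres
  rcases hα.lt_or_gt with h | h
  · have hdisj : ∀ A B : PosSemidefOp H,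
        supp (φ A).1 ⊓ supp (φ B).1 = ⊥ ↔ supp A.1 ⊓ supp B.1 = ⊥ := fun A B => by
      by_cases hA : A.1 = 0
      · rw [supp_eq_bot_iff.2 hA, supp_eq_bot_iff.2 ((hz A).2 hA)]
        simp
      · rw [← flatD_eq_top_iff_of_lt h hA, ← flatD_eq_top_iff_of_lt h (mt (hz A).1 hA), hpres]
    -- Inclusion is expressible by disjointness alone; projections onto lines suffice as tests.
    have hle : ∀ A B : PosSemidefOp H, supp A.1 ≤ supp B.1 ↔
        ∀ C : PosSemidefOp H, supp B.1 ⊓ supp C.1 = ⊥ → supp A.1 ⊓ supp C.1 = ⊥ := fun A B => by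
      refine ⟨fun hAB C hC => eq_bot_iff.2 ((inf_le_inf_right _ hAB).trans hC.le), fun hC => ?_⟩
      intro x hx
      by_contra hxB
      have h1 := hC ⟨(ℂ ∙ x).starProjection, starProjection_isPositive _⟩
      rw [supp_starProjection] at h1
      have h2 : supp B.1 ⊓ (ℂ ∙ x) = ⊥ := by
        rw [← disjoint_iff, Submodule.disjoint_span_singleton']
        · exact hxB
        · rintro rfl
          exact hxB (zero_mem _)
      have h3 : x ∈ supp A.1 ⊓ (ℂ ∙ x) := ⟨hx, Submodule.mem_span_singleton_self x⟩
      rw [h1 h2, Submodule.mem_bot] at h3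
      exact hxB (h3 ▸ zero_mem _)
    rw [hle, hle, hφ.surjective.forall]
    simp only [hdisj]
  · by_cases hA : A.1 = 0
    · rw [supp_eq_bot_iff.2 hA, supp_eq_bot_iff.2 ((hz A).2 hA)]
      simp
    · rw [← not_iff_not, ← flatD_eq_top_iff_of_gt h hA,
        ← flatD_eq_top_iff_of_gt h (mt (hz A).1 hA), hpres]

theorem exists_orderIso_supp {φ : PosSemidefOp H → PosSemidefOp H}
    (hφ : Function.Surjective φ)
    (hle : ∀ A B, supp (φ A).1 ≤ supp (φ B).1 ↔ supp A.1 ≤ supp B.1) :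
    ∃ F : Submodule ℂ H ≃o Submodule ℂ H, ∀ A, supp (φ A).1 = F (supp A.1) := by
  let p : Submodule ℂ H → PosSemidefOp H :=
    fun M => ⟨M.starProjection, starProjection_isPositive M⟩
  have hp : ∀ M, supp (p M).1 = M := supp_starProjection
  let f : Submodule ℂ H ↪o Submodule ℂ H :=
    OrderEmbedding.ofMapLEIff (fun M => supp (φ (p M)).1) fun M N => by
      rw [hle, hp, hp]
  have hf : ∀ A, supp (φ A).1 = f (supp A.1) := fun A => by
    apply le_antisymm
    · exact (hle _ _).2 (hp _).ge
    · exact (hle _ _).2 (hp _).le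
  refine ⟨RelIso.ofSurjective f fun M => ?_, hf⟩
  obtain ⟨A, hA⟩ := hφ (p M)
  exact ⟨supp A.1, by rw [← hf, hA, hp]⟩

/-- `x'` spans the image of the line spanned by `x` and has the same norm as `x`. -/
def LineRel (F : Submodule ℂ H ≃o Submodule ℂ H) (x x' : H) : Prop :=
  ‖x'‖ = ‖x‖ ∧ (ℂ ∙ x') = F (ℂ ∙ x)

theorem exists_lineRel (F : Submodule ℂ H ≃o Submodule ℂ H) (x : H) :
    ∃ x', LineRel F x x' := by
  by_cases hx : x = 0
  · exact ⟨0, by rw [hx], by rw [hx, Submodule.span_zero_singleton, F.map_bot]⟩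
  have h := (F.isAtom_iff (ℂ ∙ x)).2 (nonzero_span_atom x hx)
  obtain ⟨z, hz, hzF⟩ := (atom_iff_nonzero_span _).1 h
  have hz' : (‖z‖ : ℂ) ≠ 0 := by simpa using hz
  have hx' : (‖x‖ : ℂ) ≠ 0 := by simpa using hx
  refine ⟨((‖x‖ : ℂ) / ‖z‖) • z, ?_, ?_⟩
  · rw [norm_smul, norm_div, Complex.norm_real, Complex.norm_real, norm_norm, norm_norm,
      div_mul_cancel₀ _ (norm_ne_zero_iff.2 hz)]
  · rw [hzF, Submodule.span_singleton_smul_eq (div_ne_zero hx' hz').isUnit]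

theorem LineRel.symm {F : Submodule ℂ H ≃o Submodule ℂ H} {x x' : H} (h : LineRel F x x') :
    LineRel F.symm x' x :=
  ⟨h.1.symm, by rw [h.2, F.symm_apply_apply]⟩

theorem LineRel.smul {F : Submodule ℂ H ≃o Submodule ℂ H} {x x' : H} (h : LineRel F x x')
    {c : ℂ} (hc : c ≠ 0) : LineRel F (c • x) (c • x') :=
  ⟨by rw [norm_smul, norm_smul, h.1], by
    rw [Submodule.span_singleton_smul_eq hc.isUnit, Submodule.span_singleton_smul_eq hc.isUnit,
      h.2]⟩

theorem LineRel.smul_right {F : Submodule ℂ H ≃o Submodule ℂ H} {x x' : H} {c : ℂ} (hc : ‖c‖ = 1)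
    (h : LineRel F x (c • x')) : LineRel F x x' := by
  have hc0 : c ≠ 0 := by rw [← norm_ne_zero_iff, hc]; exact one_ne_zero
  refine ⟨?_, ?_⟩
  · rw [← h.1, norm_smul, hc, one_mul]
  · rw [← h.2, Submodule.span_singleton_smul_eq hc0.isUnit]

theorem LineRel.mem_iff {F : Submodule ℂ H ≃o Submodule ℂ H} {x x' : H} (h : LineRel F x x')
    (M : Submodule ℂ H) : x' ∈ F M ↔ x ∈ M := by
  rw [← Submodule.span_singleton_le_iff_mem, h.2, F.le_iff_le, Submodule.span_singleton_le_iff_mem]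

theorem supp_one : supp (1 : H →L[ℂ] H) = ⊤ := by
  rw [← Submodule.starProjection_top', supp_starProjection]

/-- The identity operator as an element of `L(H)_+`. -/
def oneOp : PosSemidefOp H := ⟨1, ContinuousLinearMap.isPositive_one⟩

theorem re_inner_smul_apply_smul (r : ℝ) (L : H →L[ℂ] H) (x : H) :
    (inner ℂ ((r : ℂ) • x) (L ((r : ℂ) • x))).re = r ^ 2 * (inner ℂ x (L x)).re := by
  rw [map_smul, inner_smul_left, inner_smul_right, Complex.conj_ofReal, Complex.re_ofReal_mul,
    Complex.re_ofReal_mul]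
  ring

/-- Test with the projection onto the line of `x`. The unknown constants of `flatD_rank_one` are
eliminated by comparing `B` with the identity, whose logarithm is 0. -/
theorem re_inner_logHat_of_lineRel {α : ℝ} (hα : α ≠ 1) {φ : PosSemidefOp H → PosSemidefOp H}
    (hpres : ∀ A B, flatD α (φ A) (φ B) = flatD α A B) {F : Submodule ℂ H ≃o Submodule ℂ H}
    (hF : ∀ A, supp (φ A).1 = F (supp A.1)) {x x' : H} (h : LineRel F x x') {B : PosSemidefOp H}
    (hB : x ∈ supp B.1) :
    (inner ℂ x' (logHat (φ B).1 x')).re =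
      (inner ℂ x (logHat B.1 x)).re + (inner ℂ x' (logHat (φ oneOp).1 x')).re := by
  by_cases hx : x = 0
  · have hx' : x' = 0 := by rw [← norm_eq_zero, h.1, hx, norm_zero]
    simp [hx, hx']
  wlog hn : ‖x‖ = 1 generalizing x x'
  · have hxn : ‖x‖ ≠ 0 := norm_ne_zero_iff.2 hx
    have hr : ((‖x‖⁻¹ : ℝ) : ℂ) ≠ 0 := by simpa using hx
    have h1 := this (h.smul hr) (Submodule.smul_mem _ _ hB) (smul_ne_zero hr hx) (by
      rw [norm_smul, Complex.norm_real, norm_inv, norm_norm, inv_mul_cancel₀ hxn])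
    rw [re_inner_smul_apply_smul, re_inner_smul_apply_smul, re_inner_smul_apply_smul,
      ← mul_add] at h1
    exact mul_left_cancel₀ (pow_ne_zero 2 (inv_ne_zero hxn)) h1
  let A : PosSemidefOp H := ⟨(ℂ ∙ x).starProjection, starProjection_isPositive _⟩
  have hA : supp A.1 = ℂ ∙ x := supp_starProjection _
  obtain ⟨κ, hκ⟩ := flatD_rank_one hα hn hA
  obtain ⟨κ', hκ'⟩ := flatD_rank_one (A := φ A) hα (h.1.trans hn) (by rw [hF, hA, h.2])
  have key : ∀ C : PosSemidefOp H, x ∈ supp C.1 →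
      κ' - (inner ℂ x' (logHat (φ C).1 x')).re = κ - (inner ℂ x (logHat C.1 x)).re := fun C hC => by
    have h1 := hpres A C
    rw [hκ C hC, hκ' (φ C) (by rwa [hF, h.mem_iff])] at h1
    exact EReal.coe_injective h1
  have h1 := key B hB
  have h2 := key oneOp (by rw [oneOp, supp_one]; trivial)
  rw [show logHat (oneOp : PosSemidefOp H).1 = 0 from logHat_one, zero_apply, inner_zero_right,
    Complex.zero_re] at h2
  linarith

theorem re_inner_rankOne (x y : H) :
    (inner ℂ x (InnerProductSpace.rankOne ℂ y y x)).re = ‖(inner ℂ x y : ℂ)‖ ^ 2 := by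
  rw [InnerProductSpace.rankOne_apply, inner_smul_right, ← inner_conj_symm,
    ← Complex.normSq_eq_conj_mul_self, Complex.ofReal_re, Complex.normSq_eq_norm_sq]

theorem norm_inner_sq_le_of_lineRel {F : Submodule ℂ H ≃o Submodule ℂ H} {y y' : H}
    (hy : ‖y‖ = 1) (h : LineRel F y y') {W : H →L[ℂ] H} (hW : IsSelfAdjoint W)
    (hWF : ∀ x x', LineRel F x x' → (inner ℂ x' (W x')).re = ‖(inner ℂ x y : ℂ)‖ ^ 2)
    {x x' : H} (hx : LineRel F x x') : ‖(inner ℂ x' y' : ℂ)‖ ^ 2 ≤ ‖(inner ℂ x y : ℂ)‖ ^ 2 := by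
  have hsurj : ∀ z, ∃ x, LineRel F x z := fun z => by
    obtain ⟨x, hx⟩ := exists_lineRel F.symm z
    exact ⟨x, hx.symm⟩
  rw [← hWF x x' hx]
  refine norm_inner_sq_le_of_bounds hW (fun z => ?_) (fun z => ?_) (h.1.trans hy) ?_ x'
  · obtain ⟨w, hw⟩ := hsurj z
    rw [hWF w z hw, hw.1]
    have := norm_inner_le_norm (𝕜 := ℂ) w y
    rw [hy, mul_one] at this
    gcongr
  · obtain ⟨w, hw⟩ := hsurj z
    rw [hWF w z hw]
    positivity
  · rw [hWF y y' h, norm_inner_self_eq, hy]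
    norm_num

theorem norm_inner_eq_of_lineRel {α : ℝ} (hα : α ≠ 1) {φ : PosSemidefOp H → PosSemidefOp H}
    (hφ : Function.Surjective φ)
    (hpres : ∀ A B, flatD α (φ A) (φ B) = flatD α A B) {F : Submodule ℂ H ≃o Submodule ℂ H}
    (hF : ∀ A, supp (φ A).1 = F (supp A.1)) {x x' y y' : H} (hx : LineRel F x x')
    (hy : LineRel F y y') : ‖(inner ℂ x' y' : ℂ)‖ = ‖(inner ℂ x y : ℂ)‖ := by
  by_cases hy0 : y = 0
  · have hy' : y' = 0 := by rw [← norm_eq_zero, hy.1, hy0, norm_zero]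
    simp [hy0, hy']
  wlog hn : ‖y‖ = 1 generalizing y y'
  · have hxn : ‖y‖ ≠ 0 := norm_ne_zero_iff.2 hy0
    have hr : ((‖y‖⁻¹ : ℝ) : ℂ) ≠ 0 := by simpa using hy0
    have h1 := this (hy.smul hr) (smul_ne_zero hr hy0) (by
      rw [norm_smul, Complex.norm_real, norm_inv, norm_norm, inv_mul_cancel₀ hxn])
    rw [inner_smul_right, inner_smul_right, norm_mul, norm_mul] at h1
    exact mul_left_cancel₀ (norm_ne_zero_iff.2 hr) h1
  have hrank : ∀ z : H, IsSelfAdjoint (InnerProductSpace.rankOne ℂ z z) := fun z =>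
    (InnerProductSpace.isPositive_rankOne_self z).isSelfAdjoint
  refine (sq_eq_sq₀ (norm_nonneg _) (norm_nonneg _)).1 (le_antisymm ?_ ?_)
  · obtain ⟨B, hB, hBL⟩ := exists_logHat_eq (hrank y)
    refine norm_inner_sq_le_of_lineRel hn hy
      ((isSelfAdjoint_logHat (φ B).1).sub (isSelfAdjoint_logHat (φ oneOp).1))
      (fun z z' hz => ?_) hx
    rw [sub_apply, inner_sub_right, Complex.sub_re,
      re_inner_logHat_of_lineRel hα hpres hF hz (B := B) (by rw [hB]; trivial), hBL,
      re_inner_rankOne]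
    ring
  -- Adding log φ(1) to the rank-one operator cancels the correction term, so for the preimage `B`
  -- the form of `logHat B.1` itself is |⟨·, y'⟩|² on corresponding vectors.
  · obtain ⟨C, hC, hCL⟩ := exists_logHat_eq ((hrank y').add (isSelfAdjoint_logHat (φ oneOp).1))
    obtain ⟨B, rfl⟩ := hφ C
    rw [hF] at hC
    replace hC := F.injective (hC.trans F.map_top.symm)
    refine norm_inner_sq_le_of_lineRel (hy.1.trans hn) hy.symm (isSelfAdjoint_logHat B.1)
      (fun z z' hz => ?_) hx.symm
    have h1 := re_inner_logHat_of_lineRel hα hpres hF hz.symm (B := B) (by rw [hC]; trivial)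
    rw [hCL, add_apply, inner_add_right, Complex.add_re, re_inner_rankOne] at h1
    linarith

theorem exists_orthonormalBasis_map {σ : ℂ →+* ℂ} {V : H → H}
    (hV : ∀ x y, inner ℂ (V x) (V y) = σ (inner ℂ x y))
    (b : OrthonormalBasis (Fin (Module.finrank ℂ H)) ℂ H) :
    ∃ b' : OrthonormalBasis (Fin (Module.finrank ℂ H)) ℂ H, ∀ i, b' i = V (b i) := by
  classical
  have hon : Orthonormal ℂ fun i => V (b i) := by
    rw [orthonormal_iff_ite]
    intro i j
    rw [hV, orthonormal_iff_ite.1 b.orthonormal i j]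
    split_ifs <;> simp
  refine ⟨OrthonormalBasis.mk hon (hon.linearIndependent.span_eq_top_of_card_eq_finrank'
    (by simp)).ge, fun i => by simp⟩

theorem diagOp_isSelfAdjoint {ι : Type*} [Fintype ι] (b : OrthonormalBasis ι ℂ H) (t : ι → ℝ) :
    IsSelfAdjoint (diagOp b t) := by
  refine isSelfAdjoint_sum _ fun i _ => ?_
  rw [Complex.coe_smul]
  exact (IsSelfAdjoint.all (t i)).smul
    (InnerProductSpace.isPositive_rankOne_self (b i)).isSelfAdjoint

theorem re_inner_diagOp {ι : Type*} [Fintype ι] (b : OrthonormalBasis ι ℂ H) (t : ι → ℝ) (x : H) :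
    (inner ℂ x (diagOp b t x)).re = ∑ i, t i * ‖(inner ℂ x (b i) : ℂ)‖ ^ 2 := by
  rw [diagOp, sum_apply, inner_sum, Complex.re_sum]
  refine Finset.sum_congr rfl fun i _ => ?_
  rw [smul_apply, inner_smul_right, Complex.re_ofReal_mul, re_inner_rankOne]

/-- The data of an isometry implementing `φ` on lines. -/
structure Implements (σ : ℂ →+* ℂ) [RingHomInvPair σ σ] (φ : PosSemidefOp H → PosSemidefOp H)
    (U : H ≃ₛₗᵢ[σ] H) : Prop where
  inner_map : ∀ x y, inner ℂ (U x) (U y) = σ (inner ℂ x y)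
  norm_map : ∀ z, ‖σ z‖ = ‖z‖
  ofReal_map : ∀ r : ℝ, σ r = r
  mem_supp_iff : ∀ B x, U x ∈ supp (φ B).1 ↔ x ∈ supp B.1
  re_inner_logHat : ∀ B x, x ∈ supp B.1 → (inner ℂ (U x) (logHat (φ B).1 (U x))).re =
      (inner ℂ x (logHat B.1 x)).re + (inner ℂ (U x) (logHat (φ oneOp).1 (U x))).re

/-! ### From the isometry on lines to the formula for `φ`. -/

namespace Implements

variable {σ : ℂ →+* ℂ} [RingHomInvPair σ σ] {φ : PosSemidefOp H → PosSemidefOp H}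
  {U : H ≃ₛₗᵢ[σ] H}

theorem inner_symm (h : Implements σ φ U) (x y : H) :
    inner ℂ (U.symm x) (U.symm y) = σ (inner ℂ x y) := by
  conv_rhs => rw [← U.apply_symm_apply x, ← U.apply_symm_apply y, h.inner_map]
  rw [RingHomInvPair.comp_apply_eq]

theorem supp_eq_top (h : Implements σ φ U) {B : PosSemidefOp H} (hB : supp B.1 = ⊤) :
    supp (φ B).1 = ⊤ := by
  refine eq_top_iff.2 fun y _ => ?_
  rw [← U.apply_symm_apply y, h.mem_supp_iff, hB]
  trivial

theorem sum_norm_inner (h : Implements σ φ U) {ι : Type*} [Fintype ι]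
    {b b' : OrthonormalBasis ι ℂ H} (hb : ∀ i, b' i = U (b i)) (t : ι → ℝ) (x : H) :
    (inner ℂ (U x) (diagOp b' t (U x))).re = (inner ℂ x (diagOp b t x)).re := by
  rw [re_inner_diagOp, re_inner_diagOp]
  refine Finset.sum_congr rfl fun i _ => ?_
  rw [hb, h.inner_map, h.norm_map]

theorem exists_logHat_one_eq_smul (h : Implements σ φ U) [Nontrivial H] {α : ℝ} (hα : α ≠ 1)
    (hpres : ∀ A B, flatD α (φ A) (φ B) = flatD α A B) :
    ∃ t : ℝ, logHat (φ oneOp).1 = (t : ℂ) • 1 := by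
  have hT := isSelfAdjoint_logHat (φ oneOp).1
  obtain ⟨e, t, he⟩ := exists_eigenbasis hT
  -- Operators diagonal in `d` correspond to operators diagonal in `e`, which commute with log φ(1).
  obtain ⟨d, hd⟩ := exists_orthonormalBasis_map h.inner_symm e
  have hed : ∀ i, e i = U (d i) := fun i => by rw [hd, U.apply_symm_apply]
  have hone : supp (oneOp : PosSemidefOp H).1 = ⊤ := supp_one
  have hφone : supp (φ oneOp).1 = ⊤ := h.supp_eq_top hone
  have htop : (⊤ : Submodule ℂ H) ≠ ⊥ := top_ne_bot
  have hone0 : (oneOp : PosSemidefOp H).1 ≠ 0 := by rwa [ne_eq, ← supp_eq_bot_iff, hone]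
  have hφone0 : (φ oneOp).1 ≠ 0 := by rwa [ne_eq, ← supp_eq_bot_iff, hφone]
  have hα' : 1 - α ≠ 0 := sub_ne_zero.2 hα.symm
  have htr1 : tr (oneOp : PosSemidefOp H).1 = Module.finrank ℂ H := by
    rw [tr_eq_sum d (t := fun _ => 1) (fun i => by simp [oneOp])]
    simp
  have htr2 : tr (φ oneOp).1 = ∑ i, Real.exp (t i) :=
    tr_eq_sum e fun i => apply_eq_of_logHat_apply (φ oneOp).2 (by rw [hφone]; trivial) (he i)
  have hS := tr_pos (φ oneOp).2 hφone0
  have hn := tr_pos (oneOp : PosSemidefOp H).2 hone0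
  have main : ∀ i, Real.exp (t i) = tr (φ oneOp).1 / tr (oneOp : PosSemidefOp H).1 := fun i => by
    classical
    -- This value doubles the `i`-th term of each trace of an exponential. With n = dim H and S = tr
    -- φ(1), equality of divergences reads (n + 1)/n = (S + exp tᵢ)/S, so exp tᵢ = S/n for every i.
    set τ : Fin (Module.finrank ℂ H) → ℝ := Pi.single i (Real.log 2 / (1 - α)) with hτ
    obtain ⟨B, hB, hBL⟩ := exists_logHat_eq (diagOp_isSelfAdjoint d τ)
    have hφB : supp (φ B).1 = ⊤ := h.supp_eq_top hB
    have hLφB : logHat (φ B).1 = diagOp e τ + logHat (φ oneOp).1 := by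
      refine clm_ext_re_inner (isSelfAdjoint_logHat _) ((diagOp_isSelfAdjoint e τ).add hT)
        fun z => ?_
      obtain ⟨x, rfl⟩ := U.surjective z
      rw [h.re_inner_logHat B x (by rw [hB]; trivial), add_apply, inner_add_right, Complex.add_re,
        h.sum_norm_inner hed, hBL]
    obtain ⟨hp1, hQ1, hD1⟩ := flatD_of_supp_eq_top (α := α) hone0 hone hB
    obtain ⟨hp2, hQ2, hD2⟩ := flatD_of_supp_eq_top (α := α) hφone0 hφone hφB
    have hQ : flatQ α (φ oneOp).1 (φ B).1 = flatQ α oneOp.1 B.1 := by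
      have h1 := hpres oneOp B
      rw [hD1, hD2] at h1
      exact Real.log_injOn_pos hp2 hp1
        (mul_left_cancel₀ (inv_ne_zero (sub_ne_zero.2 hα)) (EReal.coe_injective h1))
    have hE1 : tr (NormedSpace.exp (α • logHat (oneOp : PosSemidefOp H).1 +
        (1 - α) • logHat B.1)) = ∑ j, Real.exp ((1 - α) * τ j) := by
      refine tr_eq_sum d fun j => exp_apply_eigenvector (((IsSelfAdjoint.all α).smul
        (isSelfAdjoint_logHat _)).add ((IsSelfAdjoint.all (1 - α)).smul
        (isSelfAdjoint_logHat _))) ?_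
      rw [show logHat (oneOp : PosSemidefOp H).1 = 0 from logHat_one, smul_zero, zero_add, hBL,
        smul_apply, diagOp_apply, Complex.coe_smul, Complex.coe_smul, smul_smul]
    have hE2 : tr (NormedSpace.exp (α • logHat (φ oneOp).1 + (1 - α) • logHat (φ B).1)) =
        ∑ j, Real.exp (t j + (1 - α) * τ j) := by
      refine tr_eq_sum e fun j => exp_apply_eigenvector (((IsSelfAdjoint.all α).smul
        (isSelfAdjoint_logHat _)).add ((IsSelfAdjoint.all (1 - α)).smul
        (isSelfAdjoint_logHat _))) ?_
      rw [hLφB, add_apply, smul_apply, smul_apply, add_apply, diagOp_apply, he, Complex.coe_smul,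
        Complex.coe_smul, Complex.coe_smul, smul_add, smul_smul, smul_smul, smul_smul,
        ← add_smul, ← add_smul]
      congr 1
      ring
    have hexp : ∀ j, Real.exp ((1 - α) * τ j) = 1 + if j = i then 1 else 0 := fun j => by
      by_cases hj : j = i
      · rw [hj, hτ, Pi.single_eq_same, mul_div_cancel₀ _ hα', Real.exp_log two_pos, if_pos rfl]
        norm_num
      · rw [hτ, Pi.single_eq_of_ne hj, mul_zero, Real.exp_zero, if_neg hj, add_zero]
    rw [hQ1, hQ2, hE1, hE2] at hQ
    simp only [Real.exp_add, hexp, mul_add, mul_one, Finset.sum_add_distrib, mul_ite, mul_zero,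
      Finset.sum_ite_eq', Finset.mem_univ, if_true, Finset.sum_const, Finset.card_univ,
      Fintype.card_fin, nsmul_eq_mul] at hQ
    rw [← htr2, ← htr1] at hQ
    field_simp at hQ ⊢
    linarith
  refine ⟨Real.log (tr (φ oneOp).1 / tr (oneOp : PosSemidefOp H).1), clm_ext_basis e fun i => ?_⟩
  rw [he, ← main i, Real.log_exp]
  simp

theorem eq_smul_conj (h : Implements σ φ U) {t : ℝ} (ht : logHat (φ oneOp).1 = (t : ℂ) • 1)
    (A : PosSemidefOp H) (x : H) :
    (φ A).1 x = (Real.exp t : ℂ) • U (A.1 (U.symm x)) := by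
  obtain ⟨b, a, hb⟩ := exists_eigenbasis A.2.isSelfAdjoint
  obtain ⟨b', hb'⟩ := exists_orthonormalBasis_map h.inner_map b
  have ha : ∀ i, 0 ≤ a i := fun i => eigenvalue_nonneg A.2 (b.orthonormal.ne_zero i) (hb i)
  have hLA : logHat A.1 = diagOp b fun i => Real.log (a i) := clm_ext_basis b fun i => by
    rw [logHat_apply_eigenvector A.2.isSelfAdjoint (hb i), diagOp_apply]
  have hLsa := isSelfAdjoint_logHat (φ A).1
  set S := supp (φ A).1 with hS
  have hP : IsSelfAdjoint S.starProjection := isSelfAdjoint_starProjection S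
  set N : H →L[ℂ] H := diagOp b' (fun i => Real.log (a i)) + (t : ℂ) • 1 with hN
  have hNsa : IsSelfAdjoint N := by
    rw [hN, Complex.coe_smul]
    exact (diagOp_isSelfAdjoint _ _).add ((IsSelfAdjoint.all t).smul (IsSelfAdjoint.one _))
  -- The form of log φ(A) is known only on the support, so only compressions can be compared.
  have hcomp : S.starProjection * logHat (φ A).1 * S.starProjection =
      S.starProjection * N * S.starProjection := by
    refine clm_ext_re_inner (isSelfAdjoint_conj hP hLsa) (isSelfAdjoint_conj hP hNsa) fun z => ?_
    have hz : S.starProjection z ∈ S := Submodule.starProjection_apply_mem _ _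
    rw [mul_apply_eq_comp, mul_apply_eq_comp, mul_apply_eq_comp, mul_apply_eq_comp,
      ← inner_apply_left hP, ← inner_apply_left hP]
    generalize S.starProjection z = w at hz
    obtain ⟨v, rfl⟩ := U.surjective w
    rw [h.re_inner_logHat A v ((h.mem_supp_iff A v).1 hz), hN, add_apply, inner_add_right,
      Complex.add_re, h.sum_norm_inner hb', hLA, ht]
  have key : ∀ i, (φ A).1 (b' i) = ((Real.exp t * a i : ℝ) : ℂ) • b' i := fun i => by
    rcases (ha i).eq_or_lt with h0 | h0
    · rw [← h0, mul_zero, Complex.ofReal_zero, zero_smul]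
      have hker : b' i ∈ Sᗮ := by
        rw [Submodule.mem_orthogonal]
        intro u hu
        rw [← U.apply_symm_apply u, hb', h.inner_map, ← inner_conj_symm,
          (Submodule.mem_orthogonal _ _).1 ((h.mem_supp_iff A (U.symm u)).1
            (by rwa [U.apply_symm_apply])) (b i) (by simp [hb, ← h0]), map_zero, map_zero]
      rw [hS, supp, Submodule.orthogonal_orthogonal] at hker
      exact hker
    · have hmem : b i ∈ supp A.1 := by
        have h1 := Submodule.smul_mem _ ((a i : ℂ)⁻¹) (apply_mem_supp A.2.isSelfAdjoint (b i))
        rwa [hb, inv_smul_smul₀ (by exact_mod_cast h0.ne')] at h1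
      have hmem' : b' i ∈ S := by rw [hb']; exact (h.mem_supp_iff A _).2 hmem
      have hNb : N (b' i) = ((Real.log (a i) + t : ℝ) : ℂ) • b' i := by
        rw [hN, add_apply, diagOp_apply, smul_apply, one_apply_eq_self, ← add_smul, Complex.ofReal_add]
      have h1 := congrArg (fun M : H →L[ℂ] H => M (b' i)) hcomp
      simp only [mul_apply_eq_comp, Submodule.starProjection_eq_self_iff.2 hmem'] at h1
      rw [hNb, Submodule.starProjection_eq_self_iff.2
        (logHat_apply_mem_supp (φ A).2.isSelfAdjoint _),
        Submodule.starProjection_eq_self_iff.2 (Submodule.smul_mem _ _ hmem')] at h1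
      rw [apply_eq_of_logHat_apply (φ A).2 hmem' h1, Real.exp_add, Real.exp_log h0, mul_comm]
  have hlin : ((φ A).1 : H →ₗ[ℂ] H) = (Real.exp t : ℂ) •
      (U.toLinearEquiv.toLinearMap.comp ((A.1 : H →ₗ[ℂ] H).comp
        U.symm.toLinearEquiv.toLinearMap) : H →ₗ[ℂ] H) := by
    refine b'.toBasis.ext fun i => ?_
    have h1 : U (A.1 (U.symm (b' i))) = (a i : ℂ) • b' i := by
      rw [hb', U.symm_apply_apply, hb, map_smulₛₗ, h.ofReal_map]
    simp only [OrthonormalBasis.coe_toBasis, ContinuousLinearMap.coe_coe, LinearMap.smul_apply]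
    rw [key, Complex.ofReal_mul, mul_smul]
    exact congrArg _ h1.symm
  exact congrArg (fun M : H →ₗ[ℂ] H => M x) hlin

end Implements

end Preservers

end RenyiFlat

theorem mainTheorem2 {H : Type*} [NormedAddCommGroup H] [InnerProductSpace ℂ H]
    [CompleteSpace H] [FiniteDimensional ℂ H] (hd : 2 ≤ Module.finrank ℂ H)
    (α : ℝ) (hα0 : 0 < α) (hα1 : α ≠ 1)
    (φ : RenyiFlat.PosSemidefOp H → RenyiFlat.PosSemidefOp H)
    (hφ : Function.Bijective φ)
    (hpres : ∀ A B : RenyiFlat.PosSemidefOp H,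
      RenyiFlat.flatD α (φ A) (φ B) = RenyiFlat.flatD α A B) :
    ∃ c : ℝ, 0 < c ∧
      ((∃ U : H ≃ₗᵢ[ℂ] H, ∀ (A : RenyiFlat.PosSemidefOp H) (x : H),
          (φ A).1 x = (c : ℂ) • U (A.1 (U.symm x))) ∨
        (∃ U : H ≃ₗᵢ⋆[ℂ] H, ∀ (A : RenyiFlat.PosSemidefOp H) (x : H),
          (φ A).1 x = (c : ℂ) • U (A.1 (U.symm x)))) := by
  have : Nontrivial H := Module.nontrivial_of_finrank_pos (R := ℂ) (by omega)
  obtain ⟨F, hF⟩ := RenyiFlat.exists_orderIso_supp hφ.surjective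
    (RenyiFlat.supp_le_iff_of_flatD hα1 hφ hpres)
  choose f hf using RenyiFlat.exists_lineRel F
  have main : ∀ (σ : ℂ →+* ℂ) [RingHomInvPair σ σ] (U : H ≃ₛₗᵢ[σ] H),
      (∀ x y, inner ℂ (U x) (U y) = σ (inner ℂ x y)) → (∀ z, ‖σ z‖ = ‖z‖) →
      (∀ r : ℝ, σ r = r) → (∀ x, ∃ c : ℂ, ‖c‖ = 1 ∧ f x = c • U x) →
      ∃ c : ℝ, 0 < c ∧ ∀ (A : RenyiFlat.PosSemidefOp H) (x : H),
          (φ A).1 x = (c : ℂ) • U (A.1 (U.symm x)) := by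
    intro σ _ U hin hnorm hreal hU
    -- `LineRel` ignores phases, so the arbitrary choice `f` can be replaced by `U`.
    have hrel : ∀ x, RenyiFlat.LineRel F x (U x) := fun x => by
      obtain ⟨c, hc, hcx⟩ := hU x
      exact RenyiFlat.LineRel.smul_right hc (hcx ▸ hf x)
    have himp : RenyiFlat.Implements σ φ U :=
      ⟨hin, hnorm, hreal, fun B x => by rw [hF, (hrel x).mem_iff],
        fun B x hx => RenyiFlat.re_inner_logHat_of_lineRel hα1 hpres hF (hrel x) hx⟩
    obtain ⟨t, ht⟩ := himp.exists_logHat_one_eq_smul hα1 hpres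
    exact ⟨Real.exp t, Real.exp_pos t, himp.eq_smul_conj ht⟩
  rcases RenyiFlat.wigner f fun x y =>
    RenyiFlat.norm_inner_eq_of_lineRel hα1 hφ.surjective hpres hF (hf x) (hf y) with
    ⟨U, hin, hU⟩ | ⟨U, hin, hU⟩
  · obtain ⟨c, hc, h⟩ := main (RingHom.id ℂ) U hin (fun _ => rfl) (fun _ => rfl) hU
    exact ⟨c, hc, Or.inl ⟨U, h⟩⟩
  · obtain ⟨c, hc, h⟩ := main (starRingEnd ℂ) U hin (fun z => RCLike.norm_conj z)
      Complex.conj_ofReal hU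
    exact ⟨c, hc, Or.inr ⟨U, h⟩⟩
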